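/- For an integer $x$ let $P_8(x)=3x^2-2x$ (a generalized octagonal number). The quaternary sum $P_8(x)+P_8(y)+3P_8(z)+6P_8(t)$ is universal over $\mathbb Z$; that is, for every integer $n\ge 0$ there exist integers $x,y,z,t$ such that $$P_8(x)+P_8(y)+3P_8(z)+6P_8(t)=n.$$ -/

import Mathlib

/-- The generalized octagonal number `P₈(x) = 3x² - 2x` attached to an integer `x`. -/
def octagonal (x : ℤ) : ℤ := 3 * x ^ 2 - 2 * x

/-- The quaternary sum `a P₈(x) + b P₈(y) + c P₈(z) + d P₈(t)` of generalized octagonal numbers. -/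
def octagonalSum (a b c d x y z t : ℤ) : ℤ :=
  a * octagonal x + b * octagonal y + c * octagonal z + d * octagonal t

/-- The quaternary sum with coefficients `a, b, c, d` is universal over `ℤ`:
it takes every non-negative integer value at integer arguments. -/
def UniversalOctagonalSum (a b c d : ℤ) : Prop :=
  ∀ n : ℤ, 0 ≤ n → ∃ x y z t : ℤ, octagonalSum a b c d x y z t = n

/-!
Completing the square, `3 P₈(x) + 1 = (3x - 1)²`, so a representation of `n` amounts to writing
`N = 3n + 11` as `X² + Y² + 3Z² + 6T²` with `X, Y, Z, T` all prime to `3`.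

Since `3` is the norm of `1 ± √-2`, three times a nonzero value of `k² + 2t²` is again a value
`Z² + 2T²`, and `Z, T` can be chosen prime to `3` (`exists_three_mul_norm`). It therefore suffices
to write `N = X² + Y² + 9k² + 18t²` with `t ≠ 0` and `X, Y` prime to `3`. As `N ≡ 2 [MOD 3]`, any
expression of `N - 18t²` as a sum of three squares has exactly one term divisible by `3`, so only
the sum of three squares is needed. One of `t = 1, 2` puts `N - 18t²` into a class `1` or `2`
modulo `4`; this requires `N ≥ 72`, and smaller `N` are checked directly.

That every `m ≡ 1, 2 [MOD 4]` is a sum of three squares is proved in the classical way. Dirichlet's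
theorem on primes in arithmetic progressions and quadratic reciprocity provide a `d` such that `-d`
is a square modulo `dm - 1`; this yields a positive definite integral ternary form of determinant
`1` representing `m`, and reduction theory (`ternary_unimodular_sum_three_sq`) shows that the values
of such a form are sums of three squares.
-/

/-! ### Reduction of binary and ternary quadratic forms -/

/-- Every residue class modulo `a` has a representative of absolute value at most `a / 2`. -/
theorem exists_four_mul_sq_add_mul_le (a b : ℤ) (ha : 0 < a) :
    ∃ k : ℤ, 4 * (b + k * a) ^ 2 ≤ a ^ 2 := by
  have h : ∃ k : ℤ, -a ≤ 2 * (b + k * a) ∧ 2 * (b + k * a) ≤ a := by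
    refine ⟨-((2 * b + a) / (2 * a)), ?_, ?_⟩
    · have := Int.mul_ediv_self_le (x := 2 * b + a) (k := 2 * a) (by omega)
      linarith
    · have := Int.lt_mul_ediv_self_add (x := 2 * b + a) (k := 2 * a) (by omega)
      linarith
  obtain ⟨k, h₁, h₂⟩ := h
  exact ⟨k, by nlinarith⟩

/-- Gauss reduction: a positive definite binary form `(A, 2B, C)` of determinant `D` takes, at the
first column of a matrix in `SL₂(ℤ)`, a positive value at most `√(4D/3)`. -/
theorem exists_reduced_binary (A : ℤ) : ∀ B C : ℤ, 0 < A → 0 < A * C - B ^ 2 →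
    ∃ p q r s : ℤ, p * s - q * r = 1 ∧ 0 < A * p ^ 2 + 2 * B * p * r + C * r ^ 2 ∧
      3 * (A * p ^ 2 + 2 * B * p * r + C * r ^ 2) ^ 2 ≤ 4 * (A * C - B ^ 2) := by
  induction hn : A.toNat using Nat.strong_induction_on generalizing A with
  | _ n ih =>
    intro B C hA hD
    obtain ⟨k, hk⟩ := exists_four_mul_sq_add_mul_le A B hA
    obtain ⟨B', hB'⟩ : ∃ B', B' = B + k * A := ⟨_, rfl⟩
    obtain ⟨C', hC'⟩ : ∃ C', C' = A * k ^ 2 + 2 * B * k + C := ⟨_, rfl⟩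
    have hdet : A * C' - B' ^ 2 = A * C - B ^ 2 := by rw [hB', hC']; ring
    rw [← hB'] at hk
    rcases le_or_gt A C' with h | h
    · exact ⟨1, 0, 0, 1, by norm_num, by simpa using hA, by nlinarith⟩
    · have hC'0 : 0 < C' := by
        by_contra! hneg
        nlinarith [sq_nonneg B']
      obtain ⟨p, q, r, s, h1, h2, h3⟩ := ih C'.toNat (by omega) C' rfl (-B') A hC'0 (by nlinarith)
      have hval : A * (p * k - r) ^ 2 + 2 * B * (p * k - r) * p + C * p ^ 2 =
          C' * p ^ 2 + 2 * (-B') * p * r + A * r ^ 2 := by rw [hB', hC']; ring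
      refine ⟨p * k - r, q * k - s, p, q, by linarith, by rwa [hval], ?_⟩
      rw [hval]
      linarith

/-- Every value of a positive definite integral ternary form of determinant `1` is a sum of three
squares. With `a` the first diagonal coefficient, completing the square splits off a binary form
of determinant `a`; reducing it produces a basis whose second diagonal coefficient is at most
`a / 4 + √(4 / (3a))`, which is smaller than `a` unless `a = 1`. Exchanging the two basis vectors
gives an induction on `a`, and for `a = 1` the form splits into squares explicitly. -/
theorem ternary_unimodular_sum_three_sq (a : ℤ) : ∀ b c d e f : ℤ, 0 < a → 0 < a * d - b ^ 2 →
    a * (d * f - e ^ 2) - b * (b * f - c * e) + c * (b * e - c * d) = 1 → ∀ x y z : ℤ,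
    ∃ u v w : ℤ, a * x ^ 2 + d * y ^ 2 + f * z ^ 2 + 2 * b * x * y + 2 * c * x * z + 2 * e * y * z
      = u ^ 2 + v ^ 2 + w ^ 2 := by
  induction hn : a.toNat using Nat.strong_induction_on generalizing a with
  | _ n ih =>
    intro b c d e f ha hA hdet x y z
    -- `a` times the form is `(a x + b y + c z)²` plus a binary form of determinant `a` in `y, z`.
    have hD : (a * d - b ^ 2) * (a * f - c ^ 2) - (a * e - b * c) ^ 2 = a := by
      linear_combination a * hdet
    obtain ⟨p, q, r, s, hps, hpos, hle⟩ := exists_reduced_binary _ (a * e - b * c) (a * f - c ^ 2) hA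
      (by rw [hD]; exact ha)
    rw [hD] at hle
    obtain ⟨A, hA'⟩ : ∃ A, A = (a * d - b ^ 2) * p ^ 2 + 2 * (a * e - b * c) * p * r +
      (a * f - c ^ 2) * r ^ 2 := ⟨_, rfl⟩
    rw [← hA'] at hpos hle
    rcases (show a = 1 ∨ 2 ≤ a by omega) with rfl | ha2
    · have hA1 : A = 1 := by nlinarith
      -- In the reduced basis the binary part is `Y² + 2B'YZ + (1 + B'²)Z² = (Y + B'Z)² + Z²`.
      refine ⟨x + b * y + c * z, (s * y - q * z) +
        ((d - b ^ 2) * p * q + (e - b * c) * (p * s + q * r) + (f - c ^ 2) * r * s) * (p * z - r * y),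
        p * z - r * y, ?_⟩
      have hC : (d - b ^ 2) * q ^ 2 + 2 * (e - b * c) * q * s + (f - c ^ 2) * s ^ 2 =
          1 + ((d - b ^ 2) * p * q + (e - b * c) * (p * s + q * r) + (f - c ^ 2) * r * s) ^ 2 := by
        have hA1' := hA'.symm.trans hA1
        linear_combination (p * s - q * r) ^ 2 * hD + (p * s - q * r + 1) * hps -
          ((d - b ^ 2) * q ^ 2 + 2 * (e - b * c) * q * s + (f - c ^ 2) * s ^ 2) * hA1'
      have hy : y = p * (s * y - q * z) + q * (p * z - r * y) := by linear_combination -y * hps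
      have hz : z = r * (s * y - q * z) + s * (p * z - r * y) := by linear_combination -z * hps
      have hA1' := hA'.symm.trans hA1
      generalize s * y - q * z = Y at *
      generalize p * z - r * y = Z at *
      subst hy hz
      linear_combination Y ^ 2 * hA1' + Z ^ 2 * hC
    · obtain ⟨k, hk⟩ := exists_four_mul_sq_add_mul_le a (b * p + c * r) ha
      -- The new basis is `k e₁ + p e₂ + r e₃`, `e₁`, `q e₂ + s e₃`; the first vector has norm `δ` and
      -- inner product `β` with `e₁`.
      obtain ⟨β, hβ⟩ : ∃ β, β = b * p + c * r + k * a := ⟨_, rfl⟩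
      obtain ⟨δ, hδ⟩ : ∃ δ, δ = d * p ^ 2 + 2 * e * p * r + f * r ^ 2 + 2 * k * (b * p + c * r) +
        k ^ 2 * a := ⟨_, rfl⟩
      rw [← hβ] at hk
      have hmul : δ * a - β ^ 2 = A := by rw [hδ, hβ, hA']; ring
      have hδ0 : 0 < δ := by
        by_contra! hneg
        nlinarith [sq_nonneg β]
      have hAlt : 4 * A < 3 * a ^ 2 := by
        by_contra! hge
        nlinarith
      have hδa : δ < a := by
        by_contra! hge
        nlinarith
      obtain ⟨u, v, w, h⟩ := ih δ.toNat (by omega) δ rfl β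
        (k * (b * q + c * s) + d * p * q + e * (p * s + q * r) + f * r * s) a (b * q + c * s)
        (d * q ^ 2 + 2 * e * q * s + f * s ^ 2) hδ0 (by rw [hmul]; exact hpos) (by
          rw [hδ, hβ]
          linear_combination (p * s - q * r) ^ 2 * hdet + (p * s - q * r + 1) * hps)
        (s * y - q * z) (x - k * (s * y - q * z)) (p * z - r * y)
      refine ⟨u, v, w, ?_⟩
      rw [← h, hδ, hβ]
      have hy : y = p * (s * y - q * z) + q * (p * z - r * y) := by linear_combination -y * hps
      have hz : z = r * (s * y - q * z) + s * (p * z - r * y) := by linear_combination -z * hps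
      generalize s * y - q * z = Y at *
      generalize p * z - r * y = Z at *
      subst hy hz
      ring

/-! ### Sums of three squares -/

/-- If `t² + d = e (dm - 1)`, then the symmetric matrix with rows `(e, t, 1)`, `(t, dm - 1, 0)`,
`(1, 0, m)` is positive definite of determinant `1`, and its form represents `m`. -/
theorem sum_three_sq_of_isSquare_neg (m d : ℕ) (hd : 0 < d) (h1 : 1 < d * m)
    (h : IsSquare (-(d : ZMod (d * m - 1)))) :
    ∃ u v w : ℤ, (m : ℤ) = u ^ 2 + v ^ 2 + w ^ 2 := by
  obtain ⟨t, ht⟩ := h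
  obtain ⟨t, rfl⟩ := ZMod.intCast_surjective t
  have hdvd : ((d * m - 1 : ℕ) : ℤ) ∣ t ^ 2 + d := by
    rw [← ZMod.intCast_zmod_eq_zero_iff_dvd]
    push_cast
    rw [sq, ← ht]
    ring
  obtain ⟨e, he⟩ := hdvd
  rw [Nat.cast_sub h1.le] at he
  push_cast at he
  have h1' : (1 : ℤ) < d * m := by exact_mod_cast h1
  have hd' : (0 : ℤ) < d := by exact_mod_cast hd
  have he0 : 0 < e := by
    by_contra! hneg
    nlinarith [sq_nonneg t]
  obtain ⟨u, v, w, h⟩ := ternary_unimodular_sum_three_sq e t 1 (d * m - 1) 0 m he0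
    (by nlinarith) (by linear_combination -(m : ℤ) * he) 0 0 1
  exact ⟨u, v, w, by rw [← h]; ring⟩

/-- Dirichlet's theorem gives a prime `p = dm - 1` with `d ≡ 1 [MOD 4]`. Then `p ≡ 1 [MOD 4]`,
and reciprocity gives `(-d / p) = (p / d) = (-1 / d) = 1`. -/
theorem Nat.sum_three_sq_of_mod_four_eq_two (m : ℕ) (hm : m % 4 = 2) :
    ∃ u v w : ℤ, (m : ℤ) = u ^ 2 + v ^ 2 + w ^ 2 := by
  have hco : (m - 1).Coprime (4 * m) := by
    refine Nat.Coprime.mul_right ?_ ?_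
    · have : Odd (m - 1) := by rw [Nat.odd_iff]; omega
      exact (Nat.Coprime.pow_right 2 this.coprime_two_right : (m - 1).Coprime (2 ^ 2))
    · exact (Nat.coprime_self_sub_left (by omega)).2 m.coprime_one_left
  obtain ⟨p, hp1, hp, hmod⟩ := Nat.forall_exists_prime_gt_and_modEq m (by omega : 4 * m ≠ 0) hco
  obtain ⟨j, hj⟩ := (Nat.modEq_iff_dvd' (by omega)).1 hmod.symm
  have hpd : (4 * j + 1) * m - 1 = p := by
    have : (4 * j + 1) * m = 4 * m * j + m := by ring
    omega
  have hp4 : p % 4 = 1 := by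
    have : p = 4 * (m * j) + (m - 1) := by rw [← mul_assoc]; omega
    omega
  have : Fact p.Prime := ⟨hp⟩
  have hj1 : 1 < (4 * j + 1) * m := by have := hp.two_le; omega
  refine sum_three_sq_of_isSquare_neg m (4 * j + 1) (by omega) hj1 ?_
  rw [hpd]
  have hodd : Odd p := hp.odd_of_ne_two (by rintro rfl; omega)
  have key : jacobiSym (-((4 * j + 1 : ℕ) : ℤ)) p = 1 := by
    rw [jacobiSym.neg _ hodd, ZMod.χ₄_nat_one_mod_four hp4, one_mul,
      jacobiSym.quadratic_reciprocity_one_mod_four (by omega) hodd,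
      jacobiSym.mod_left' (a₂ := -1), jacobiSym.at_neg_one (by rw [Nat.odd_iff]; omega),
      ZMod.χ₄_nat_one_mod_four (by omega)]
    refine Int.ModEq.symm ((Int.modEq_iff_dvd).2 ⟨m, ?_⟩)
    rw [← hpd, Nat.cast_sub hj1.le]
    push_cast
    ring
  simpa using ZMod.isSquare_of_jacobiSym_eq_one key

/-- Dirichlet's theorem gives a prime `p` with `2p = dm - 1` and `d ≡ 3 [MOD 8]`. Reciprocity gives
`(-d / p) = (p / d) = (-2 / d) (-2p / d) = 1`, so `-d` is a square modulo `p`, hence modulo `2p`. -/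
theorem Nat.sum_three_sq_of_mod_four_eq_one (m : ℕ) (hm : m % 4 = 1) :
    ∃ u v w : ℤ, (m : ℤ) = u ^ 2 + v ^ 2 + w ^ 2 := by
  obtain ⟨h, hh⟩ : ∃ h, 2 * h + 1 = 3 * m := ⟨(3 * m - 1) / 2, by omega⟩
  have hco : h.Coprime (4 * m) := by
    refine Nat.Coprime.mul_right ?_ ?_
    · have : Odd h := by rw [Nat.odd_iff]; omega
      exact (Nat.Coprime.pow_right 2 this.coprime_two_right : h.Coprime (2 ^ 2))
    · rw [← Nat.isCoprime_iff_coprime]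
      exact ⟨-2, 3, by push_cast [← @Nat.cast_inj ℤ] at hh; linarith⟩
  obtain ⟨p, hp1, hp, hmod⟩ := Nat.forall_exists_prime_gt_and_modEq (h + 2)
    (by omega : 4 * m ≠ 0) hco
  obtain ⟨j, hj⟩ := (Nat.modEq_iff_dvd' (by omega)).1 hmod.symm
  have hpd : (8 * j + 3) * m = 2 * p + 1 := by
    have : (8 * j + 3) * m = 2 * (4 * m * j) + 3 * m := by ring
    omega
  have : Fact p.Prime := ⟨hp⟩
  have hodd : Odd p := hp.odd_of_ne_two (by omega)
  have hdodd : Odd (8 * j + 3) := by rw [Nat.odd_iff]; omega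
  refine sum_three_sq_of_isSquare_neg m (8 * j + 3) (by omega) (by omega) ?_
  have hrec : jacobiSym (-((8 * j + 3 : ℕ) : ℤ)) p = jacobiSym p (8 * j + 3) := by
    rw [jacobiSym.neg _ hodd]
    rcases Nat.odd_mod_four_iff.1 (Nat.odd_iff.1 hodd) with h4 | h4
    · rw [ZMod.χ₄_nat_one_mod_four h4, one_mul,
        jacobiSym.quadratic_reciprocity_one_mod_four' hdodd h4]
    · rw [ZMod.χ₄_nat_three_mod_four h4,
        jacobiSym.quadratic_reciprocity_three_mod_four (by omega) h4]
      ring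
  have h2p : jacobiSym (-2 * p) (8 * j + 3) = 1 := by
    rw [jacobiSym.mod_left' (a₂ := 1), jacobiSym.one_left]
    refine Int.ModEq.symm ((Int.modEq_iff_dvd).2 ⟨-m, ?_⟩)
    have : ((8 * j + 3 : ℕ) : ℤ) * m = 2 * p + 1 := by exact_mod_cast hpd
    linear_combination this
  have h2 : jacobiSym (-2) (8 * j + 3) = 1 := by
    rw [jacobiSym.at_neg_two hdodd, ZMod.χ₈'_nat_eq_if_mod_eight]
    have : (8 * j + 3) % 8 = 3 := by omega
    have : (8 * j + 3) % 2 = 1 := by omega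
    simp [*]
  rw [jacobiSym.mul_left, h2, one_mul] at h2p
  obtain ⟨t, ht⟩ := ZMod.isSquare_of_jacobiSym_eq_one (hrec.trans h2p)
  obtain ⟨t, rfl⟩ := ZMod.intCast_surjective t
  -- A square root of `-d` modulo the odd prime `p` can be shifted by `p` to become odd; it is then
  -- a square root modulo `2p` because `d` is odd.
  obtain ⟨s, hs_odd, hs⟩ : ∃ s : ℤ, Odd s ∧ (p : ℤ) ∣ s * s + (8 * j + 3 : ℕ) := by
    have hdvd : (p : ℤ) ∣ t * t + (8 * j + 3 : ℕ) := by
      rw [← ZMod.intCast_zmod_eq_zero_iff_dvd]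
      push_cast at ht ⊢
      rw [← ht]
      ring
    rcases Int.even_or_odd t with hev | hod
    · refine ⟨t + p, hev.add_odd (by exact_mod_cast hodd), ?_⟩
      have : (t + p) * (t + p) + (8 * j + 3 : ℕ) =
        t * t + (8 * j + 3 : ℕ) + p * (2 * t + p) := by ring
      rw [this]
      exact hdvd.add (dvd_mul_right _ _)
    · exact ⟨t, hod, hdvd⟩
  have hs2 : (2 : ℤ) ∣ s * s + (8 * j + 3 : ℕ) :=
    ((hs_odd.mul hs_odd).add_odd (by exact_mod_cast hdodd)).two_dvd
  have hcop : IsCoprime (2 : ℤ) p := by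
    exact_mod_cast Nat.isCoprime_iff_coprime.2 hodd.coprime_two_left
  have hall := hcop.mul_dvd hs2 hs
  have hN : (8 * j + 3) * m - 1 = 2 * p := by omega
  rw [hN]
  refine ⟨(s : ZMod (2 * p)), ?_⟩
  have := (ZMod.intCast_zmod_eq_zero_iff_dvd (s * s + (8 * j + 3 : ℕ)) (2 * p)).2 (by exact_mod_cast hall)
  push_cast at this ⊢
  linear_combination -this

/-! ### Values of `Z² + 2T²` with both arguments prime to `3` -/

/-- Multiply `z + t√-2` by `1 + √-2` or `1 - √-2`, both of norm `3`. Modulo `3`, the coordinates of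
the products are, up to sign, `z + t` and `z - t` respectively, and these are not both zero. -/
theorem exists_three_mul_norm_of_not_dvd (z t : ℤ) (h : ¬ (3 ∣ z ∧ 3 ∣ t)) :
    ∃ Z T : ℤ, ¬ 3 ∣ Z ∧ ¬ 3 ∣ T ∧ Z ^ 2 + 2 * T ^ 2 = 3 * (z ^ 2 + 2 * t ^ 2) := by
  by_cases hzt : 3 ∣ z + t
  · exact ⟨z + 2 * t, t - z, by omega, by omega, by ring⟩
  · exact ⟨z - 2 * t, t + z, by omega, by omega, by ring⟩

/-- A factor `3` common to `z` and `t` contributes `9` to the norm, which two further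
multiplications by `1 ± √-2` restore while keeping both coordinates prime to `3`. -/
theorem exists_three_mul_norm (z t : ℤ) (ht : t ≠ 0) :
    ∃ Z T : ℤ, ¬ 3 ∣ Z ∧ ¬ 3 ∣ T ∧ Z ^ 2 + 2 * T ^ 2 = 3 * (z ^ 2 + 2 * t ^ 2) := by
  induction hn : t.natAbs using Nat.strong_induction_on generalizing z t with
  | _ n ih =>
    by_cases h : 3 ∣ z ∧ 3 ∣ t
    · obtain ⟨⟨z, rfl⟩, ⟨t, rfl⟩⟩ := h
      obtain ⟨Z₁, T₁, hZ₁, -, h₁⟩ := ih t.natAbs (by omega) z t (by omega) rfl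
      obtain ⟨Z₂, T₂, hZ₂, -, h₂⟩ := exists_three_mul_norm_of_not_dvd Z₁ T₁ (fun h ↦ hZ₁ h.1)
      obtain ⟨Z₃, T₃, hZ₃, hT₃, h₃⟩ := exists_three_mul_norm_of_not_dvd Z₂ T₂ (fun h ↦ hZ₂ h.1)
      exact ⟨Z₃, T₃, hZ₃, hT₃, by linear_combination h₃ + 3 * h₂ + 9 * h₁⟩
    · exact exists_three_mul_norm_of_not_dvd z t h

/-! ### Octagonal sums -/

/-- `3 P₈(x) + 1 = (3x - 1)²`, and up to sign every integer prime to `3` is of the form `3x - 1`. -/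
theorem exists_octagonal_of_sq (X : ℤ) (h : ¬ 3 ∣ X) : ∃ x : ℤ, 3 * octagonal x + 1 = X ^ 2 := by
  rcases (by omega : X % 3 = 1 ∨ X % 3 = 2) with h | h
  · refine ⟨(1 - X) / 3, ?_⟩
    obtain ⟨k, hk⟩ : ∃ k, X = 3 * k + 1 := ⟨X / 3, by omega⟩
    have : (1 - X) / 3 = -k := by omega
    rw [this, hk, octagonal]; ring
  · obtain ⟨k, hk⟩ : ∃ k, X = 3 * k - 1 := ⟨(X + 1) / 3, by omega⟩
    exact ⟨k, by rw [hk, octagonal]; ring⟩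

theorem sq_emod_three (x : ℤ) : 3 ∣ x ∧ x ^ 2 % 3 = 0 ∨ ¬ 3 ∣ x ∧ x ^ 2 % 3 = 1 := by
  rcases (by omega : x % 3 = 0 ∨ x % 3 = 1 ∨ x % 3 = 2) with h | h | h <;>
    simp [Int.dvd_iff_emod_eq_zero, sq, Int.mul_emod, h]

/-- Modulo `3` a sum of three squares is the number of terms prime to `3`, so when `m ≡ 2 [MOD 3]`
exactly one of the three terms is divisible by `3`. -/
theorem exists_not_dvd_sq_add_sq_add_nine_mul_sq (m : ℕ) (h3 : m % 3 = 2)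
    (h4 : m % 4 = 1 ∨ m % 4 = 2) :
    ∃ X Y k : ℤ, ¬ 3 ∣ X ∧ ¬ 3 ∣ Y ∧ (m : ℤ) = X ^ 2 + Y ^ 2 + 9 * k ^ 2 := by
  obtain ⟨u, v, w, h⟩ : ∃ u v w : ℤ, (m : ℤ) = u ^ 2 + v ^ 2 + w ^ 2 :=
    h4.elim m.sum_three_sq_of_mod_four_eq_one m.sum_three_sq_of_mod_four_eq_two
  rcases sq_emod_three u with ⟨hu, hu'⟩ | ⟨hu, hu'⟩ <;>
  rcases sq_emod_three v with ⟨hv, hv'⟩ | ⟨hv, hv'⟩ <;>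
  rcases sq_emod_three w with ⟨hw, hw'⟩ | ⟨hw, hw'⟩ <;> try omega
  · obtain ⟨k, rfl⟩ := hu
    exact ⟨v, w, k, hv, hw, by rw [h]; ring⟩
  · obtain ⟨k, rfl⟩ := hv
    exact ⟨u, w, k, hu, hw, by rw [h]; ring⟩
  · obtain ⟨k, rfl⟩ := hw
    exact ⟨u, v, k, hu, hv, by rw [h]; ring⟩

theorem exists_octagonalSum_eq_of_lt (n : ℕ) (hn : n < 21) :
    ∃ x y z t : ℤ, octagonalSum 1 1 3 6 x y z t = n := by
  have h : ∀ n ∈ List.range 21, ∃ x ∈ [0, 1, -1, 2, -2], ∃ y ∈ [0, 1, -1, 2], ∃ z ∈ [0, 1, -1],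
      ∃ t ∈ [0, 1], octagonalSum 1 1 3 6 x y z t = n := by decide +kernel
  obtain ⟨x, -, y, -, z, -, t, -, h⟩ := h n (List.mem_range.2 hn)
  exact ⟨x, y, z, t, h⟩

theorem theorem2p2 : UniversalOctagonalSum 1 1 3 6 := by
  intro n hn
  lift n to ℕ using hn
  rcases lt_or_ge n 21 with hlt | hge
  · exact exists_octagonalSum_eq_of_lt n hlt
  -- `18 t²` is `2` modulo `4` for `t = 1` and `0` for `t = 2`: one of the two moves `3n + 11` into
  -- the classes `1, 2` modulo `4`. The bound `n ≥ 21` keeps `3n + 11 - 72` nonnegative.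
  obtain ⟨m, t, ht, hm, hm3, hm4⟩ : ∃ (m : ℕ) (t : ℤ), t ≠ 0 ∧ m + 18 * t ^ 2 = 3 * n + 11 ∧
      m % 3 = 2 ∧ (m % 4 = 1 ∨ m % 4 = 2) := by
    by_cases h : n % 4 = 0 ∨ n % 4 = 3
    · exact ⟨3 * n + 11 - 18, 1, by omega, by omega, by omega, by omega⟩
    · exact ⟨3 * n + 11 - 72, 2, by omega, by omega, by omega, by omega⟩
  obtain ⟨X, Y, k, hX, hY, hXY⟩ := exists_not_dvd_sq_add_sq_add_nine_mul_sq m hm3 hm4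
  obtain ⟨Z, T, hZ, hT, hZT⟩ := exists_three_mul_norm k t ht
  obtain ⟨x, hx⟩ := exists_octagonal_of_sq X hX
  obtain ⟨y, hy⟩ := exists_octagonal_of_sq Y hY
  obtain ⟨z, hz⟩ := exists_octagonal_of_sq Z hZ
  obtain ⟨t', ht'⟩ := exists_octagonal_of_sq T hT
  refine ⟨x, y, z, t', ?_⟩
  rw [octagonalSum]
  linarith
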